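/- Let $X$ be a nonempty compact Hausdorff space, $\alpha\colon X\to X$ a continuous map, and $a\in C(X)$ a nonnegative function. Let $M_\alpha(X)$ be the set of regular Borel $\alpha$-invariant probability measures on $X$ and $EM_\alpha(X)\subset M_\alpha(X)$ the subset of ergodic measures. Let $X_\alpha$ be the essential set of $\alpha$, i.e. the set of points $x\in X$ such that for every neighbourhood $V$ of $x$ there is $\mu\in M_\alpha(X)$ with $\mu(V)>0$; one has $\alpha(X_\alpha)=X_\alpha$. For $x\in X_\alpha$ and $n\in\mathbb N$ put $\tilde\alpha^{-n}(x):=\alpha^{-n}(x)\cap X_\alpha$, and assume that $\alpha$ is a finite-sheeted cover on $X_\alpha$, i.e. $\sup_{x\in X_\alpha}|\tilde\alpha^{-1}(x)|<\infty$. Put $$\omega(\alpha):=\ln\limsup_{n\to\infty}\sup_{x\in X_\alpha}|\tilde\alpha^{-n}(x)|^{1/n},\qquad \ell(\alpha,a):=\ln\lim_{n\to\infty}\sup_{x\in X_\alpha}\Bigl(\sum_{y\in\tilde\alpha^{-n}(x)}\prod_{i=0}^{n-1}a(\alpha^i(y))\Bigr)^{1/n},$$ where $\ln 0=-\infty$ and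 integrals of $\ln a$ take values in $[-\infty,\infty)$. Then the limit defining $\ell(\alpha,a)$ exists, the maxima below are attained, and $$\max_{\mu\in M_\alpha(X)}\int_X\ln a\,d\mu=\max_{\mu\in EM_\alpha(X)}\int_X\ln a\,d\mu\le\ell(\alpha,a)\le\max_{\mu\in EM_\alpha(X)}\int_X\ln a\,d\mu+\omega(\alpha).$$ -/

import Mathlib

open MeasureTheory Filter
open scoped ENNReal Topology

noncomputable section

/-- The integral `∫ f dμ ∈ [-∞, ∞]` of an extended-real-valued function, as the integral of the
positive part minus the integral of the negative part (used when the former is finite). -/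
def extIntegral {X : Type*} [MeasurableSpace X] (μ : Measure X) (f : X → EReal) : EReal :=
  ((∫⁻ x, (f x).toENNReal ∂μ : ℝ≥0∞) : EReal) - ((∫⁻ x, (-f x).toENNReal ∂μ : ℝ≥0∞) : EReal)

/-- `ln ∘ a` for a nonnegative function `a`, with `ln 0 = -∞`. -/
def lnFun {X : Type*} (a : X → ℝ) (x : X) : EReal :=
  ENNReal.log (ENNReal.ofReal (a x))

/-- `M_α(X)`: the regular Borel `α`-invariant probability measures on `X`. -/
def invariantMeasures {X : Type*} [TopologicalSpace X] [MeasurableSpace X] (α : X → X) :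
    Set (Measure X) :=
  {μ | IsProbabilityMeasure μ ∧ μ.Regular ∧ MeasurePreserving α μ μ}

/-- `EM_α(X)`: the ergodic elements of `M_α(X)`. -/
def ergodicMeasures {X : Type*} [TopologicalSpace X] [MeasurableSpace X] (α : X → X) :
    Set (Measure X) :=
  {μ | μ ∈ invariantMeasures α ∧ Ergodic α μ}

/-- The essential set `X_α`: the points each of whose neighbourhoods is charged by some
`μ ∈ M_α(X)`. -/
def essentialSet {X : Type*} [TopologicalSpace X] [MeasurableSpace X] (α : X → X) : Set X :=
  {x | ∀ V ∈ 𝓝 x, ∃ μ ∈ invariantMeasures α, 0 < μ V}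

/-- The `n`-fold preimage of `x` inside the essential set, `α^{-n}(x) ∩ X_α`. -/
def essentialPreimage {X : Type*} [TopologicalSpace X] [MeasurableSpace X] (α : X → X)
    (n : ℕ) (x : X) : Set X :=
  {y | y ∈ essentialSet α ∧ α^[n] y = x}

/-- `α` is a finite-sheeted cover on `X_α`: the numbers of points in the sets
`α^{-1}(x) ∩ X_α`, `x ∈ X_α`, are uniformly bounded. -/
def IsFiniteSheetedOnEssentialSet {X : Type*} [TopologicalSpace X] [MeasurableSpace X]
    (α : X → X) : Prop :=
  (⨆ x ∈ essentialSet α, (essentialPreimage α 1 x).encard) < ⊤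

/-- The inverse rami-rate
`ω(α) = ln limsup_n sup_{x ∈ X_α} |α^{-n}(x) ∩ X_α|^{1/n}`. -/
def inverseRamiRate {X : Type*} [TopologicalSpace X] [MeasurableSpace X] (α : X → X) : EReal :=
  ENNReal.log (limsup (fun n : ℕ => ⨆ x ∈ essentialSet α,
    ((essentialPreimage α n x).encard : ℝ≥0∞) ^ (1 / (n : ℝ))) atTop)

/-- `sup_{x ∈ X_α} (∑_{y ∈ α^{-n}(x) ∩ X_α} ∏_{i < n} a(α^i(y)))^{1/n}`. -/
def essentialGrowth {X : Type*} [TopologicalSpace X] [MeasurableSpace X] (α : X → X)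
    (a : X → ℝ) (n : ℕ) : ℝ≥0∞ :=
  ⨆ x ∈ essentialSet α,
    (∑' y : essentialPreimage α n x,
      ∏ i ∈ Finset.range n, ENNReal.ofReal (a (α^[i] (y : X)))) ^ (1 / (n : ℝ))

/-- The essential spectral potential
`ℓ(α, a) = ln lim_n sup_{x ∈ X_α} (∑_{y ∈ α^{-n}(x) ∩ X_α} ∏_{i < n} a(α^i(y)))^{1/n}`. -/
def essentialSpectralPotential {X : Type*} [TopologicalSpace X] [MeasurableSpace X]
    (α : X → X) (a : X → ℝ) : EReal :=
  ENNReal.log (limUnder atTop (essentialGrowth α a))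

end

/-! Invariant regular probability measures correspond, by Riesz representation, to the invariant
states of `C(X, ℝ)`, a compact subset of the product space of functions `C(X, ℝ) → ℝ`; extreme
states come from ergodic measures. Since `ln a` is the decreasing limit of the continuous functions
`max (ln a) (-k)`, its integral is an infimum of continuous linear functionals of the state. Its
maximizers therefore form a nonempty compact extreme subset, which contains an extreme state. This
gives an ergodic maximizer (`exists_extremePoint_isMaxOn_iInf`).

Lower bound: one term of the preimage sum suffices. If `∫ ln a dμ > c`, the `n`-step sums of the
truncations of `ln a` have mean at least `nc`, so some `y ∈ X_α` has orbit product at least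
`e^{nc}`, and `y` is one of the preimages of `α^n(y)`.

Upper bound: if all invariant states give less than `c`, then for large `n` every orbit product is
at most `e^{nc}`; otherwise empirical averages along bad orbits would accumulate at a state
violating this (`eventually_prod_le_exp`). Each preimage sum is then at most `e^{nc}` times the
number of preimages. The limit defining `ℓ(α, a)` exists by Fekete's lemma. -/

/-! ### Invariant states and invariant measures -/

/-- The `α`-invariant states of `C(X, ℝ)`: positive normalized linear functionals `Λ` with
`Λ (f ∘ α) = Λ f`. -/
def invariantStates {X : Type*} [TopologicalSpace X] (α : X → X) : Set (C(X, ℝ) → ℝ) :=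
  {Λ | (∀ f g, Λ (f + g) = Λ f + Λ g) ∧ (∀ (c : ℝ) f, Λ (c • f) = c * Λ f) ∧
    (∀ f : C(X, ℝ), (∀ x, 0 ≤ f x) → 0 ≤ Λ f) ∧ Λ 1 = 1 ∧
    ∀ f g : C(X, ℝ), (∀ x, g x = f (α x)) → Λ g = Λ f}

/-- The functional `f ↦ ∫ f dμ` on `C(X, ℝ)`. -/
noncomputable def integralFunctional {X : Type*} [TopologicalSpace X] [MeasurableSpace X]
    (μ : Measure X) : C(X, ℝ) → ℝ :=
  fun f => ∫ x, f x ∂μ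

lemma integrable_continuousMap {X : Type*} [TopologicalSpace X] [CompactSpace X]
    [MeasurableSpace X] [BorelSpace X] (μ : Measure X) [IsFiniteMeasure μ] (f : C(X, ℝ)) :
    Integrable f μ := by
  have h : Integrable (BoundedContinuousFunction.mkOfCompact f) μ :=
    BoundedContinuousFunction.integrable μ _
  exact h

lemma invariantStates_mono {X : Type*} [TopologicalSpace X] {α : X → X}
    {Λ : C(X, ℝ) → ℝ} (hΛ : Λ ∈ invariantStates α) {f g : C(X, ℝ)} (h : ∀ x, f x ≤ g x) :
    Λ f ≤ Λ g := by
  obtain ⟨hadd, -, hpos, -, -⟩ := hΛ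
  have h1 := hadd f (g - f)
  have h2 := hpos (g - f) fun x => by simpa using h x
  rw [add_sub_cancel] at h1
  linarith

lemma isClosed_invariantStates {X : Type*} [TopologicalSpace X] (α : X → X) :
    IsClosed (invariantStates α) := by
  simp only [invariantStates, Set.ofPred_and, Set.ofPred_forall]
  refine IsClosed.inter ?_ (IsClosed.inter ?_ (IsClosed.inter ?_ (IsClosed.inter ?_ ?_)))
  · exact isClosed_iInter fun f => isClosed_iInter fun g =>
      isClosed_eq (by fun_prop) (by fun_prop)
  · exact isClosed_iInter fun c => isClosed_iInter fun g =>
      isClosed_eq (by fun_prop) (by fun_prop)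
  · exact isClosed_iInter fun f => isClosed_iInter fun _ =>
      isClosed_le (by fun_prop) (by fun_prop)
  · exact isClosed_eq (by fun_prop) (by fun_prop)
  · exact isClosed_iInter fun f => isClosed_iInter fun g => isClosed_iInter fun _ =>
      isClosed_eq (by fun_prop) (by fun_prop)

/-- Positivity and normalization confine `Λ f` to `[-‖f‖, ‖f‖]`, so Tychonoff's theorem applies. -/
lemma isCompact_invariantStates {X : Type*} [TopologicalSpace X] [CompactSpace X] (α : X → X) :
    IsCompact (invariantStates α) := by
  refine (isCompact_univ_pi fun f : C(X, ℝ) =>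
    isCompact_Icc (a := -‖f‖) (b := ‖f‖)).of_isClosed_subset (isClosed_invariantStates α) ?_
  intro Λ hΛ f _
  obtain ⟨-, hsmul, -, hone, -⟩ := id hΛ
  have h1 : Λ f ≤ Λ (‖f‖ • (1 : C(X, ℝ))) :=
    invariantStates_mono hΛ fun x => by simpa using (le_abs_self _).trans (f.norm_coe_le_norm x)
  have h2 : Λ ((-‖f‖) • (1 : C(X, ℝ))) ≤ Λ f :=
    invariantStates_mono hΛ fun x => by simpa using (abs_le.1 (f.norm_coe_le_norm x)).1
  rw [hsmul, hone, mul_one] at h1 h2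
  exact ⟨h2, h1⟩

lemma integralFunctional_mem_invariantStates {X : Type*} [TopologicalSpace X] [CompactSpace X]
    [MeasurableSpace X] [BorelSpace X] {α : X → X} {μ : Measure X} [IsProbabilityMeasure μ]
    (hμ : MeasurePreserving α μ μ) : integralFunctional μ ∈ invariantStates α := by
  refine ⟨fun f g => ?_, fun c f => ?_, fun f hf => ?_, ?_, fun f g h => ?_⟩
  · exact integral_add (integrable_continuousMap μ f) (integrable_continuousMap μ g)
  · exact integral_const_mul c _
  · exact integral_nonneg hf
  · simp [integralFunctional]
  · have hf : AEStronglyMeasurable f (μ.map α) := by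
      rw [hμ.map_eq]; exact (integrable_continuousMap μ f).aestronglyMeasurable
    have := integral_map hμ.aemeasurable hf
    rw [hμ.map_eq] at this
    simp only [integralFunctional, h, this]

lemma measure_eq_of_integralFunctional_eq {X : Type*} [TopologicalSpace X] [CompactSpace X]
    [T2Space X] [MeasurableSpace X] [BorelSpace X] {μ ν : Measure X} [μ.Regular] [ν.Regular]
    (h : integralFunctional μ = integralFunctional ν) : μ = ν :=
  Measure.ext_of_integral_eq_on_compactlySupported fun f => congrFun h f.toContinuousMap

/-- **Riesz representation** of invariant states by invariant regular measures. -/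
lemma exists_invariantMeasure_of_mem_invariantStates {X : Type*} [TopologicalSpace X]
    [CompactSpace X] [T2Space X] [MeasurableSpace X] [BorelSpace X] {α : X → X}
    (hα : Continuous α) {Λ : C(X, ℝ) → ℝ} (hΛ : Λ ∈ invariantStates α) :
    ∃ μ ∈ invariantMeasures α, integralFunctional μ = Λ := by
  obtain ⟨hadd, hsmul, hpos, hone, hinv⟩ := id hΛ
  let Φ : CompactlySupportedContinuousMap X ℝ →ₚ[ℝ] ℝ :=
    { toFun := fun g => Λ g.toContinuousMap
      map_add' := fun f g => hadd _ _
      map_smul' := fun c g => hsmul _ _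
      monotone' := fun f g h => invariantStates_mono hΛ h }
  let μ := RealRMK.rieszMeasure Φ
  have hreg : μ.Regular := RealRMK.regular_rieszMeasure Φ
  have hfin : IsFiniteMeasure μ := by infer_instance
  have hint : integralFunctional μ = Λ := by
    funext f
    exact RealRMK.integral_rieszMeasure Φ
      (⟨f, HasCompactSupport.of_compactSpace f⟩ : CompactlySupportedContinuousMap X ℝ)
  have hprob : IsProbabilityMeasure μ := by
    have h1 := congrFun hint 1
    rw [hone] at h1
    simp only [integralFunctional, ContinuousMap.one_apply, integral_const, smul_eq_mul,
      mul_one] at h1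
    exact ⟨by rwa [measureReal_def, ENNReal.toReal_eq_one_iff] at h1⟩
  refine ⟨μ, ⟨hprob, hreg, hα.measurable, ?_⟩, hint⟩
  -- Integrals of continuous functions determine a measure only among regular ones, so the
  -- push-forward must be shown regular before it is compared with `μ`.
  have : (μ.map α).InnerRegularCompactLTTop := .map_of_continuous hα
  have : IsFiniteMeasure (μ.map α) := by infer_instance
  have : (μ.map α).Regular := inferInstance
  refine measure_eq_of_integralFunctional_eq ?_
  funext f
  have h2 : integralFunctional (μ.map α) f
      = integralFunctional μ (f.comp ⟨α, hα⟩) :=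
    integral_map hα.measurable.aemeasurable f.continuous.aestronglyMeasurable
  rw [h2, hint]
  exact hinv _ _ fun _ => rfl

lemma cond_mem_invariantMeasures {X : Type*} [TopologicalSpace X] [CompactSpace X] [T2Space X]
    [MeasurableSpace X] [BorelSpace X] {α : X → X} {μ : Measure X} (hμ : μ ∈ invariantMeasures α)
    {s : Set X} (hs : MeasurableSet s) (hsα : α ⁻¹' s = s) (h0 : μ s ≠ 0) :
    ProbabilityTheory.cond μ s ∈ invariantMeasures α := by
  obtain ⟨hprob, hreg, hpres⟩ := hμ
  refine ⟨ProbabilityTheory.cond_isProbabilityMeasure h0, ?_, ?_⟩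
  · have := Measure.Regular.restrict_of_measure_ne_top (μ := μ) (measure_ne_top μ s)
    exact Measure.Regular.smul (ENNReal.inv_ne_top.2 h0)
  · have := hpres.restrict_preimage hs
    rw [hsα] at this
    exact this.smul_measure _

/-- Extreme invariant states are represented by ergodic measures. -/
lemma ergodic_of_mem_extremePoints {X : Type*} [TopologicalSpace X] [CompactSpace X] [T2Space X]
    [MeasurableSpace X] [BorelSpace X] {α : X → X} {μ : Measure X} (hμ : μ ∈ invariantMeasures α)
    (hext : integralFunctional μ ∈ (invariantStates α).extremePoints ℝ) : Ergodic α μ := by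
  obtain ⟨hprob, hreg, hpres⟩ := id hμ
  refine ⟨hpres, ⟨fun s hs hsα => ?_⟩⟩
  rw [eventuallyConst_set']
  by_contra! hne
  have h0 : μ s ≠ 0 := fun h => hne.1 (ae_eq_empty.2 h)
  have h1 : μ sᶜ ≠ 0 := fun h => hne.2 (ae_eq_univ.2 h)
  have hsα' : α ⁻¹' sᶜ = sᶜ := by rw [Set.preimage_compl, hsα]
  have hc := cond_mem_invariantMeasures hμ hs hsα h0
  have hc' := cond_mem_invariantMeasures hμ hs.compl hsα' h1
  have := hc.1
  have := hc'.1
  have := hc.2.1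
  -- A nontrivial invariant set splits `μ` into its two conditional measures, with weights `μ s` and
  -- `μ sᶜ`.
  have hseg : integralFunctional μ ∈ openSegment ℝ
      (integralFunctional (ProbabilityTheory.cond μ s))
      (integralFunctional (ProbabilityTheory.cond μ sᶜ)) := by
    refine ⟨μ.real s, μ.real sᶜ, ENNReal.toReal_pos h0 (measure_ne_top _ _),
      ENNReal.toReal_pos h1 (measure_ne_top _ _), probReal_add_probReal_compl hs, ?_⟩
    funext f
    have key : ∀ t, μ t ≠ 0 →
        μ.real t * ∫ x, f x ∂(ProbabilityTheory.cond μ t) = ∫ x in t, f x ∂μ := by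
      intro t ht
      rw [ProbabilityTheory.cond, integral_smul_measure, smul_eq_mul, ← mul_assoc,
        measureReal_def, ENNReal.toReal_inv, mul_inv_cancel₀, one_mul]
      exact (ENNReal.toReal_pos ht (measure_ne_top _ _)).ne'
    simp only [integralFunctional, Pi.add_apply, Pi.smul_apply, smul_eq_mul, key s h0, key _ h1]
    exact integral_add_compl hs (integrable_continuousMap μ f)
  have heq := hext.2 (integralFunctional_mem_invariantStates hc.2.2)
    (integralFunctional_mem_invariantStates hc'.2.2) hseg
  have hμc := measure_eq_of_integralFunctional_eq heq
  -- Extremality gives `μ = cond μ s`, which does not charge `sᶜ`.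
  refine h1 ?_
  rw [← hμc, ProbabilityTheory.cond_apply hs]
  simp

/-! ### Empirical averages -/

/-- An ultrafilter limit of empirical functionals along orbit segments of growing length is an
invariant state. -/
lemma empirical_limit_mem_invariantStates {X : Type*} [TopologicalSpace X] [CompactSpace X]
    {α : X → X} (U : Ultrafilter ℕ) (hU : (U : Filter ℕ) ≤ atTop) (y : ℕ → X) :
    ∃ Λ ∈ invariantStates α, ∀ f : C(X, ℝ),
      Tendsto (fun n : ℕ => (∑ i ∈ Finset.range n, f (α^[i] (y n))) / n) U (𝓝 (Λ f)) := by
  have hbd : ∀ f : C(X, ℝ), ∀ n : ℕ,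
      (∑ i ∈ Finset.range n, f (α^[i] (y n))) / n ∈ Set.Icc (-‖f‖) ‖f‖ := by
    intro f n
    rw [Set.mem_Icc, ← abs_le, abs_div, Nat.abs_cast]
    refine div_le_of_le_mul₀ (by positivity) (norm_nonneg f) ?_
    refine (Finset.abs_sum_le_sum_abs _ _).trans ?_
    refine (Finset.sum_le_card_nsmul _ _ ‖f‖ fun i _ => f.norm_coe_le_norm _).trans ?_
    simp [mul_comm]
  have hex : ∀ f : C(X, ℝ), ∃ l : ℝ,
      Tendsto (fun n : ℕ => (∑ i ∈ Finset.range n, f (α^[i] (y n))) / n) U (𝓝 l) := by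
    intro f
    obtain ⟨l, -, hl⟩ := (isCompact_Icc (a := -‖f‖) (b := ‖f‖)).ultrafilter_le_nhds
      (U.map fun n : ℕ => (∑ i ∈ Finset.range n, f (α^[i] (y n))) / n)
      (by
        rw [le_principal_iff, Ultrafilter.mem_coe, Ultrafilter.mem_map]
        exact univ_mem' (hbd f))
    exact ⟨l, hl⟩
  choose Λ hΛ using hex
  refine ⟨Λ, ⟨fun f g => ?_, fun c f => ?_, fun f hf => ?_, ?_, fun f g h => ?_⟩, hΛ⟩
  · refine tendsto_nhds_unique (hΛ (f + g)) (((hΛ f).add (hΛ g)).congr fun n => ?_)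
    simp [Finset.sum_add_distrib, add_div]
  · refine tendsto_nhds_unique (hΛ (c • f)) (((hΛ f).const_mul c).congr fun n => ?_)
    simp [← Finset.mul_sum, mul_div_assoc]
  · refine ge_of_tendsto (hΛ f) (Filter.Eventually.of_forall fun n => ?_)
    exact div_nonneg (Finset.sum_nonneg fun i _ => hf _) (Nat.cast_nonneg n)
  · refine tendsto_nhds_unique (hΛ 1) (tendsto_const_nhds.congr' ?_)
    filter_upwards [hU (eventually_ne_atTop 0)] with n hn
    simp [hn]
  -- The sums of `f ∘ α` and `f` telescope to two boundary terms, so the averages differ by at most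
  -- `2‖f‖ / n`.
  · refine sub_eq_zero.1 (tendsto_nhds_unique ((hΛ g).sub (hΛ f)) ?_)
    have hz : Tendsto (fun n : ℕ => 2 * ‖f‖ / (n : ℝ)) U (𝓝 0) :=
      (tendsto_const_div_atTop_nhds_zero_nat _).mono_left hU
    refine squeeze_zero_norm (fun n => ?_) hz
    have : ∀ n : ℕ, ∑ i ∈ Finset.range n, g (α^[i] (y n)) - ∑ i ∈ Finset.range n, f (α^[i] (y n))
        = f (α^[n] (y n)) - f (y n) := by
      intro n
      rw [← Finset.sum_sub_distrib]
      simp only [h, ← Function.iterate_succ_apply' α]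
      exact Finset.sum_range_sub (fun i => f (α^[i] (y n))) n
    rw [← sub_div, this, norm_div, Real.norm_natCast]
    gcongr
    refine (norm_sub_le _ _).trans ?_
    have h1 := f.norm_coe_le_norm (α^[n] (y n))
    have h2 := f.norm_coe_le_norm (y n)
    linarith

/-! ### Maximization at extreme points -/

/-- A compact set and a decreasing sequence of continuous linear functionals: the infimum of the
sequence attains its maximum over the set at an extreme point. -/
lemma exists_extremePoint_isMaxOn_iInf {E : Type*} [AddCommGroup E] [Module ℝ E]
    [TopologicalSpace E] [T2Space E] [IsTopologicalAddGroup E] [ContinuousSMul ℝ E]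
    [LocallyConvexSpace ℝ E] {K : Set E} (hK : IsCompact K) (hne : K.Nonempty)
    (φ : ℕ → E →L[ℝ] ℝ) (hφ : ∀ x ∈ K, Antitone fun k => φ k x) :
    ∃ x ∈ K.extremePoints ℝ, IsMaxOn (fun x => ⨅ k, (φ k x : EReal)) K x := by
  set F : E → EReal := fun x => ⨅ k, (φ k x : EReal) with hF
  have husc : UpperSemicontinuousOn F K := upperSemicontinuousOn_iInf fun k =>
    ((continuous_coe_real_ereal.comp (φ k).continuous).upperSemicontinuous).upperSemicontinuousOn K
  obtain ⟨z, hzK, hz⟩ := UpperSemicontinuousOn.exists_isMaxOn hne hK husc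
  have hmem : ∀ x, F z ≤ F x ↔ ∀ k, F z ≤ φ k x := fun x => le_iInf_iff
  set A : Set E := {x ∈ K | F z ≤ F x} with hA
  have hAK : A ⊆ K := fun x hx => hx.1
  have hAc : IsCompact A := by
    have hcl : IsClosed {x | ∀ k, F z ≤ (φ k x : EReal)} := by
      simp only [Set.ofPred_forall]
      exact isClosed_iInter fun k => isClosed_le continuous_const
        (continuous_coe_real_ereal.comp (φ k).continuous)
    have : A = K ∩ {x | ∀ k, F z ≤ (φ k x : EReal)} := by
      ext x; simp only [hA, Set.mem_ofPred_eq, Set.mem_inter_iff, hmem]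
    rw [this]
    exact hK.inter_right hcl
  have hAext : IsExtreme ℝ K A := by
    refine ⟨hAK, ?_⟩
    rintro x hx y hy w hw ⟨s, t, hs, ht, hst, rfl⟩
    refine ⟨hx, ?_⟩
    by_contra! hlt
    obtain ⟨m, hm1, hm2⟩ := EReal.lt_iff_exists_real_btwn.1 hlt
    obtain ⟨k, hk⟩ := iInf_lt_iff.1 hm1
    have hztop : F z ≠ ⊤ := ((iInf_le (fun k => (φ k z : EReal)) 0).trans_lt (EReal.coe_lt_top _)).ne
    obtain ⟨M, hM⟩ : ∃ M : ℝ, F z = M :=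
      ⟨(F z).toReal, (EReal.coe_toReal hztop hm2.ne_bot).symm⟩
    rw [hM] at hm2
    have hmM : m < M := EReal.coe_lt_coe_iff.1 hm2
    have hk' : φ k x < m := EReal.coe_lt_coe_iff.1 hk
    -- The bound is chosen so that `s * m + t * (M + s * (M - m) / t) = M`. With `F x < m`, a common
    -- index `max k j` then puts the value at `s • x + t • y` strictly below `M`.
    have hy' : F y < ((M + s * (M - m) / t : ℝ) : EReal) := by
      refine (hz hy).trans_lt ?_
      rw [hM]
      have : 0 < s * (M - m) / t := by
        have := sub_pos.2 hmM
        positivity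
      exact EReal.coe_lt_coe_iff.2 (by linarith)
    obtain ⟨j, hj⟩ := iInf_lt_iff.1 hy'
    have hj' : φ j y < M + s * (M - m) / t := EReal.coe_lt_coe_iff.1 hj
    have h1 := hφ x hx (le_max_left k j)
    have h2 := hφ y hy (le_max_right k j)
    have h3 := (hmem _).1 hw.2 (max k j)
    rw [hM] at h3
    have h4 : M ≤ φ (max k j) (s • x + t • y) := EReal.coe_le_coe_iff.1 h3
    simp only [map_add, map_smul, smul_eq_mul] at h1 h2 h4
    have h5 : s * φ (max k j) x < s * m := mul_lt_mul_of_pos_left (h1.trans_lt hk') hs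
    have h6 : t * φ (max k j) y < t * (M + s * (M - m) / t) :=
      mul_lt_mul_of_pos_left (h2.trans_lt hj') ht
    have h7 : t * (M + s * (M - m) / t) = t * M + s * (M - m) := by field_simp
    have h8 : s * M + t * M = M := by rw [← add_mul, hst, one_mul]
    linarith
  obtain ⟨x, hx⟩ := hAc.extremePoints_nonempty ⟨z, hzK, le_rfl⟩
  exact ⟨x, hAext.extremePoints_subset_extremePoints hx, fun w hw => (hz hw).trans hx.1.2⟩

/-! ### Truncations of the logarithm -/

/-- The truncated logarithm `max (ln a) (-k)` as a continuous function. -/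
noncomputable def truncLog {X : Type*} [TopologicalSpace X] (a : X → ℝ) (ha : Continuous a)
    (k : ℕ) : C(X, ℝ) :=
  ⟨fun x => Real.log (max (a x) (Real.exp (-k))),
    (ha.max continuous_const).log fun _ => (lt_max_of_lt_right (Real.exp_pos _)).ne'⟩

lemma exp_truncLog {X : Type*} [TopologicalSpace X] (a : X → ℝ) (ha : Continuous a)
    (k : ℕ) (x : X) : Real.exp (truncLog a ha k x) = max (a x) (Real.exp (-k)) :=
  Real.exp_log (lt_max_of_lt_right (Real.exp_pos _))

lemma truncLog_antitone {X : Type*} [TopologicalSpace X] (a : X → ℝ) (ha : Continuous a) (x : X) :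
    Antitone fun k => truncLog a ha k x := by
  intro j k hjk
  rw [← Real.exp_le_exp, exp_truncLog, exp_truncLog]
  gcongr

lemma truncLog_of_nonpos {X : Type*} [TopologicalSpace X] {a : X → ℝ} (ha : Continuous a)
    {x : X} (hx : a x ≤ 0) (k : ℕ) : truncLog a ha k x = -k := by
  rw [← Real.exp_eq_exp, exp_truncLog, max_eq_right (hx.trans (Real.exp_pos _).le)]

lemma truncLog_of_pos {X : Type*} [TopologicalSpace X] {a : X → ℝ} (ha : Continuous a)
    {x : X} (hx : 0 < a x) (k : ℕ) : truncLog a ha k x = max (Real.log (a x)) (-k) := by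
  rw [← Real.exp_eq_exp, exp_truncLog, Real.exp_monotone.map_max, Real.exp_log hx]

/-- Cutting at `-k ≤ 0` alters only the negative part, so the positive part is the same for all `k`.
-/
lemma toENNReal_lnFun {X : Type*} [TopologicalSpace X] (a : X → ℝ) (ha : Continuous a) (k : ℕ)
    (x : X) : (lnFun a x).toENNReal = ENNReal.ofReal (truncLog a ha k x) := by
  have hk : (-(k : ℝ)) ≤ 0 := by simp
  rcases le_or_gt (a x) 0 with hx | hx
  · rw [truncLog_of_nonpos ha hx, lnFun, ENNReal.ofReal_of_nonpos hx, ENNReal.ofReal_of_nonpos hk,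
      ENNReal.log_zero]
    simp
  · rw [truncLog_of_pos ha hx, lnFun, ENNReal.log_ofReal_of_pos hx, EReal.toENNReal_of_ne_top
      (EReal.coe_ne_top _), EReal.toReal_coe, ENNReal.ofReal_max, ENNReal.ofReal_of_nonpos hk]
    simp

/-- The negative parts increase with `k`, which sets up monotone convergence, including where `a`
vanishes. -/
lemma toENNReal_neg_lnFun {X : Type*} [TopologicalSpace X] (a : X → ℝ) (ha : Continuous a)
    (x : X) : (-lnFun a x).toENNReal = ⨆ k, ENNReal.ofReal (-truncLog a ha k x) := by
  rcases le_or_gt (a x) 0 with hx | hx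
  · simp only [truncLog_of_nonpos ha hx, lnFun, ENNReal.ofReal_of_nonpos hx, ENNReal.log_zero,
      neg_neg, ENNReal.ofReal_natCast, ENNReal.iSup_natCast]
    simp
  · rw [lnFun, ENNReal.log_ofReal_of_pos hx, ← EReal.coe_neg, EReal.toENNReal_of_ne_top
      (EReal.coe_ne_top _), EReal.toReal_coe]
    simp only [truncLog_of_pos ha hx]
    refine le_antisymm ?_ (iSup_le fun k => ENNReal.ofReal_le_ofReal (by simp))
    obtain ⟨k, hk⟩ := exists_nat_ge (-Real.log (a x))
    refine le_iSup_of_le k (ENNReal.ofReal_le_ofReal ?_)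
    rw [max_eq_left (by linarith)]

/-- `∫ ln a dμ` is the infimum of the integrals of the truncations of `ln a`. -/
lemma extIntegral_lnFun {X : Type*} [TopologicalSpace X] [CompactSpace X] [MeasurableSpace X]
    [BorelSpace X] (μ : Measure X) [IsFiniteMeasure μ] (a : X → ℝ) (ha : Continuous a) :
    extIntegral μ (lnFun a) = ⨅ k, (integralFunctional μ (truncLog a ha k) : EReal) := by
  set P : ℝ≥0∞ := ∫⁻ x, (lnFun a x).toENNReal ∂μ with hP
  set N : ℕ → ℝ≥0∞ := fun k => ∫⁻ x, ENNReal.ofReal (-truncLog a ha k x) ∂μ with hN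
  have hPk : ∀ k, P = ∫⁻ x, ENNReal.ofReal (truncLog a ha k x) ∂μ := fun k =>
    lintegral_congr fun x => toENNReal_lnFun a ha k x
  have hPtop : P ≠ ⊤ := by
    rw [hPk 0]
    exact (integrable_continuousMap μ _).lintegral_lt_top.ne
  have hNtop : ∀ k, N k ≠ ⊤ := fun k =>
    (integrable_continuousMap μ (truncLog a ha k)).neg.lintegral_lt_top.ne
  have hmono : ∀ x, Monotone fun k => ENNReal.ofReal (-truncLog a ha k x) := fun x j k hjk =>
    ENNReal.ofReal_le_ofReal (neg_le_neg (truncLog_antitone a ha x hjk))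
  have hsup : ∫⁻ x, (-lnFun a x).toENNReal ∂μ = ⨆ k, N k := by
    simp only [toENNReal_neg_lnFun a ha]
    exact lintegral_iSup (fun k => (truncLog a ha k).continuous.measurable.neg.ennreal_ofReal)
      fun j k hjk x => hmono x hjk
  have hval : ∀ k, (integralFunctional μ (truncLog a ha k) : EReal) = (P : EReal) - N k := by
    intro k
    rw [integralFunctional, integral_eq_lintegral_pos_part_sub_lintegral_neg_part
      (integrable_continuousMap μ _), ← hPk k, EReal.coe_sub, EReal.coe_ennreal_toReal hPtop,
      EReal.coe_ennreal_toReal (hNtop k)]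
  have hNmono : Monotone N := fun j k hjk => lintegral_mono fun x => hmono x hjk
  have hlim : Tendsto (fun k => (P : EReal) - N k) atTop (𝓝 ((P : EReal) - (⨆ k, N k : ℝ≥0∞))) := by
    have h1 : Tendsto (fun k => -(N k : EReal)) atTop (𝓝 (-((⨆ k, N k : ℝ≥0∞) : EReal))) :=
      (continuous_neg.comp continuous_coe_ennreal_ereal).continuousAt.tendsto.comp
        (tendsto_atTop_iSup hNmono)
    -- Finiteness of `P` makes addition continuous here even when the negative parts tend to `∞`.
    have hPt : (P : EReal) ≠ ⊤ := by simpa using hPtop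
    have hPb : (P : EReal) ≠ ⊥ := EReal.coe_ennreal_ne_bot P
    exact (EReal.continuousAt_add (Or.inl hPt) (Or.inl hPb)).tendsto.comp
      (tendsto_const_nhds.prodMk_nhds h1)
  have hanti : Antitone fun k => (P : EReal) - N k := fun j k hjk =>
    EReal.sub_le_sub le_rfl (EReal.coe_ennreal_le_coe_ennreal_iff.2 (hNmono hjk))
  rw [extIntegral, ← hP, hsup]
  simp only [hval]
  exact tendsto_nhds_unique hlim (tendsto_atTop_iInf hanti)

/-! ### The essential set and orbit products -/

lemma isClosed_essentialSet {X : Type*} [TopologicalSpace X] [MeasurableSpace X] (α : X → X) :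
    IsClosed (essentialSet α) := by
  rw [← isOpen_compl_iff, isOpen_iff_mem_nhds]
  intro x hx
  simp only [essentialSet, Set.mem_compl_iff, Set.mem_ofPred_eq, not_forall] at hx
  obtain ⟨V, hV, h⟩ := hx
  filter_upwards [eventually_eventually_nhds.2 hV] with y hy hy'
  exact h (hy' V hy)

lemma mapsTo_essentialSet {X : Type*} [TopologicalSpace X] [MeasurableSpace X] [BorelSpace X]
    {α : X → X} (hα : Continuous α) : Set.MapsTo α (essentialSet α) (essentialSet α) := by
  intro x hx V hV
  obtain ⟨W, hWV, hW, hxW⟩ := mem_nhds_iff.1 hV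
  obtain ⟨μ, hμ, hpos⟩ := hx _ ((hW.preimage hα).mem_nhds hxW)
  rw [hμ.2.2.measure_preimage hW.measurableSet.nullMeasurableSet] at hpos
  exact ⟨μ, hμ, hpos.trans_le (measure_mono hWV)⟩

/-- The complement is open and locally null. Without a countable base this does not make it null
directly; inner regularity reduces to compact subsets, where finitely many null neighbourhoods
suffice. -/
lemma measure_compl_essentialSet {X : Type*} [TopologicalSpace X] [MeasurableSpace X]
    [BorelSpace X] {α : X → X} {μ : Measure X} (hμ : μ ∈ invariantMeasures α) :
    μ (essentialSet α)ᶜ = 0 := by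
  have := hμ.2.1
  by_contra h0
  obtain ⟨C, hCs, hC, hpos⟩ := (isClosed_essentialSet α).isOpen_compl.exists_lt_isCompact
    (pos_iff_ne_zero.2 h0)
  refine hpos.ne' (hC.measure_zero_of_nhdsWithin fun x hx => ?_)
  have hx' := hCs hx
  simp only [essentialSet, Set.mem_compl_iff, Set.mem_ofPred_eq, not_forall] at hx'
  obtain ⟨V, hV, h⟩ := hx'
  exact ⟨V, mem_nhdsWithin_of_mem_nhds hV, by
    by_contra h1
    exact h ⟨μ, hμ, pos_iff_ne_zero.2 h1⟩⟩

/-- An invariant measure with `∫ ln a dμ ≥ c` forces, for every `n`, a point of the essential set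
with `∏_{i < n} a(α^i(y)) ≥ e^{nc}`. -/
lemma exists_essential_exp_le_prod {X : Type*} [TopologicalSpace X] [CompactSpace X]
    [MeasurableSpace X] [BorelSpace X] {α : X → X} (hα : Continuous α)
    {μ : Measure X} (hμ : μ ∈ invariantMeasures α) {a : X → ℝ} (ha : Continuous a)
    (ha0 : ∀ x, 0 ≤ a x) {c : ℝ} (hc : ∀ k, c ≤ integralFunctional μ (truncLog a ha k)) (n : ℕ) :
    ∃ y ∈ essentialSet α, Real.exp (n * c) ≤ ∏ i ∈ Finset.range n, a (α^[i] y) := by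
  have := hμ.1
  set S : ℕ → X → ℝ := fun k y => ∑ i ∈ Finset.range n, truncLog a ha k (α^[i] y) with hS
  have hScont : ∀ k, Continuous (S k) := fun k =>
    continuous_finsetSum _ fun i _ => (truncLog a ha k).continuous.comp (hα.iterate i)
  have hSint : ∀ k, ∫ x, S k x ∂μ = n * integralFunctional μ (truncLog a ha k) := by
    intro k
    have hint : ∀ i : ℕ, Integrable (fun x => truncLog a ha k (α^[i] x)) μ := fun i =>
      integrable_continuousMap μ ((truncLog a ha k).comp ⟨α^[i], hα.iterate i⟩)
    have hi : ∀ i : ℕ, ∫ x, truncLog a ha k (α^[i] x) ∂μ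
        = integralFunctional μ (truncLog a ha k) := fun i =>
      (integralFunctional_mem_invariantStates (hμ.2.2.iterate i)).2.2.2.2 (truncLog a ha k)
        ((truncLog a ha k).comp ⟨α^[i], hα.iterate i⟩) fun _ => rfl
    rw [integral_finsetSum _ fun i _ => hint i]
    simp [hi]
  set C : ℕ → Set X := fun k => essentialSet α ∩ {y | n * c ≤ S k y} with hC
  have hclosed : ∀ k, IsClosed (C k) := fun k =>
    (isClosed_essentialSet α).inter (isClosed_le continuous_const (hScont k))
  -- For each `k` some point of `X_α` has `S k` at least its mean. The sets `C k` are compact and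
  -- decreasing, so a single `y` serves all `k`.
  obtain ⟨y, hy⟩ := IsCompact.nonempty_iInter_of_sequence_nonempty_isCompact_isClosed C
    (fun k y hy => ⟨hy.1, hy.2.trans (Finset.sum_le_sum fun i _ =>
      truncLog_antitone a ha _ (Nat.le_succ k))⟩)
    (fun k => by
      obtain ⟨y, hy, hle⟩ := exists_notMem_null_integral_le
        (integrable_continuousMap μ ⟨S k, hScont k⟩) (measure_compl_essentialSet hμ)
      refine ⟨y, not_not.1 hy, le_trans ?_ hle⟩
      change n * c ≤ ∫ x, S k x ∂μ
      rw [hSint]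
      exact mul_le_mul_of_nonneg_left (hc k) (Nat.cast_nonneg n))
    (hclosed 0).isCompact hclosed
  rw [Set.mem_iInter] at hy
  refine ⟨y, (hy 0).1, ?_⟩
  have hlim : Tendsto (fun k : ℕ => ∏ i ∈ Finset.range n, max (a (α^[i] y)) (Real.exp (-k)))
      atTop (𝓝 (∏ i ∈ Finset.range n, a (α^[i] y))) := by
    refine tendsto_finsetProd _ fun i _ => ?_
    have h0 : Tendsto (fun k : ℕ => Real.exp (-k)) atTop (𝓝 0) :=
      Real.tendsto_exp_neg_atTop_nhds_zero.comp tendsto_natCast_atTop_atTop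
    have := (tendsto_const_nhds (x := a (α^[i] y))).max h0
    rwa [max_eq_left (ha0 _)] at this
  refine ge_of_tendsto hlim (Filter.Eventually.of_forall fun k => ?_)
  simp only [← exp_truncLog a ha, ← Real.exp_sum]
  exact Real.exp_le_exp.2 (hy k).2

/-- If every invariant state gives `ln a` an integral less than `c`, then eventually
`∏_{i < n} a(α^i(x)) ≤ e^{nc}` uniformly in `x`. -/
lemma eventually_prod_le_exp {X : Type*} [TopologicalSpace X] [CompactSpace X]
    (α : X → X) {a : X → ℝ} (ha : Continuous a) (ha0 : ∀ x, 0 ≤ a x) {c : ℝ}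
    (hc : ∀ Λ ∈ invariantStates α, ⨅ k, (Λ (truncLog a ha k) : EReal) < c) :
    ∀ᶠ n : ℕ in atTop, ∀ x, ∏ i ∈ Finset.range n, a (α^[i] x) ≤ Real.exp (n * c) := by
  by_contra h
  rw [not_eventually] at h
  have hX : ∃ y : ℕ → X, ∃ᶠ n : ℕ in atTop,
      Real.exp (n * c) < ∏ i ∈ Finset.range n, a (α^[i] (y n)) := by
    obtain ⟨n₀, hn₀⟩ := h.exists
    push Not at hn₀
    have : ∀ n : ℕ, ∃ y : X, (¬ ∀ x, ∏ i ∈ Finset.range n, a (α^[i] x) ≤ Real.exp (n * c)) →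
        Real.exp (n * c) < ∏ i ∈ Finset.range n, a (α^[i] y) := by
      intro n
      by_cases hn : ∀ x, ∏ i ∈ Finset.range n, a (α^[i] x) ≤ Real.exp (n * c)
      · exact ⟨hn₀.choose, fun h => absurd hn h⟩
      · push Not at hn
        exact ⟨hn.choose, fun _ => hn.choose_spec⟩
    choose y hy using this
    exact ⟨y, h.mono hy⟩
  obtain ⟨y, hy⟩ := hX
  -- The ultrafilter is concentrated on the bad `n`, so every truncated average along it is at least
  -- `c`, and so is the limit.
  obtain ⟨V, hV⟩ : ∃ V : Ultrafilter ℕ, (V : Filter ℕ) ≤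
      atTop ⊓ 𝓟 {n : ℕ | Real.exp (n * c) < ∏ i ∈ Finset.range n, a (α^[i] (y n))} := by
    have : NeBot (atTop ⊓ 𝓟 {n : ℕ | Real.exp (n * c) <
        ∏ i ∈ Finset.range n, a (α^[i] (y n))}) := frequently_mem_iff_neBot.1 hy
    exact Ultrafilter.exists_le _
  have hVtop : (V : Filter ℕ) ≤ atTop := hV.trans inf_le_left
  obtain ⟨Λ, hΛ, hlim⟩ := empirical_limit_mem_invariantStates (α := α) V hVtop y
  refine (hc Λ hΛ).not_ge (le_iInf fun k => EReal.coe_le_coe_iff.2 ?_)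
  refine ge_of_tendsto (hlim (truncLog a ha k)) ?_
  filter_upwards [hV (mem_inf_of_right (mem_principal_self _)), hVtop (eventually_gt_atTop 0)]
    with n hn hn0
  have hn0' : (0 : ℝ) < n := Nat.cast_pos.2 hn0
  rw [le_div_iff₀ hn0', mul_comm, ← Real.exp_le_exp, Real.exp_sum]
  simp only [exp_truncLog]
  exact hn.le.trans (Finset.prod_le_prod (fun i _ => ha0 _) fun i _ => le_max_left _ _)

/-! ### Submultiplicativity and growth rates -/

/-- **Fekete's lemma** for submultiplicative sequences in `[0, ∞]`. -/
lemma exists_tendsto_rpow_of_submultiplicative {u : ℕ → ℝ≥0∞}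
    (hu : ∀ m n, u (m + n) ≤ u m * u n) (h1 : u 1 ≠ ⊤) :
    ∃ L : ℝ≥0∞, Tendsto (fun n : ℕ => u n ^ (1 / (n : ℝ))) atTop (𝓝 L) := by
  have htop : ∀ n, n ≠ 0 → u n ≠ ⊤ := by
    intro n hn
    induction n, Nat.one_le_iff_ne_zero.2 hn using Nat.le_induction with
    | base => exact h1
    | succ n hn' ih =>
      exact ne_top_of_le_ne_top (ENNReal.mul_ne_top (ih (by lia)) h1) (hu n 1)
  by_cases hz : ∃ N, u N = 0
  · obtain ⟨N, hN⟩ := hz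
    refine ⟨0, tendsto_const_nhds.congr' ?_⟩
    filter_upwards [eventually_ge_atTop N, eventually_gt_atTop 0] with n hn hn0
    have h0 : u n = 0 := by
      have := hu N (n - N)
      rwa [Nat.add_sub_cancel' hn, hN, zero_mul, nonpos_iff_eq_zero] at this
    rw [h0, ENNReal.zero_rpow_of_pos (by positivity)]
  push Not at hz
  -- `u 0` may be infinite; the value `v 0 = 0` keeps `v` subadditive and does not affect the limit.
  set v : ℕ → ℝ := fun n => if n = 0 then 0 else Real.log (u n).toReal with hv
  have huv : ∀ n, n ≠ 0 → u n = ENNReal.ofReal (Real.exp (v n)) := by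
    intro n hn
    simp only [hv, if_neg hn]
    rw [Real.exp_log (ENNReal.toReal_pos (hz n) (htop n hn)), ENNReal.ofReal_toReal (htop n hn)]
  have hsub : Subadditive v := by
    intro m n
    rcases eq_or_ne m 0 with rfl | hm
    · simp [hv]
    rcases eq_or_ne n 0 with rfl | hn
    · simp [hv]
    have := hu m n
    rwa [huv m hm, huv n hn, huv (m + n) (by lia), ← ENNReal.ofReal_mul (Real.exp_pos _).le,
      ENNReal.ofReal_le_ofReal_iff (by positivity), ← Real.exp_add, Real.exp_le_exp] at this
  have hroot : ∀ n : ℕ, n ≠ 0 → u n ^ (1 / (n : ℝ)) = ENNReal.ofReal (Real.exp (v n / n)) := by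
    intro n hn
    rw [huv n hn, ENNReal.ofReal_rpow_of_pos (Real.exp_pos _), ← Real.exp_mul, mul_one_div]
  refine ⟨⨅ n ∈ Set.Ici 1, u n ^ (1 / (n : ℝ)), tendsto_order.2 ⟨fun l hl => ?_, fun b hb => ?_⟩⟩
  · filter_upwards [eventually_ge_atTop 1] with n hn
    exact hl.trans_le (biInf_le _ hn)
  · obtain ⟨n, hn⟩ := iInf_lt_iff.1 hb
    obtain ⟨hn1, hnb⟩ := iInf_lt_iff.1 hn
    have hn0 : n ≠ 0 := Nat.one_le_iff_ne_zero.1 hn1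
    rcases eq_or_ne b ⊤ with rfl | hbtop
    · filter_upwards [eventually_ne_atTop 0] with p hp
      rw [hroot p hp]
      exact ENNReal.ofReal_lt_top
    have hbpos : 0 < b.toReal := ENNReal.toReal_pos (bot_le.trans_lt hnb).ne' hbtop
    have hiff : ∀ p : ℕ, p ≠ 0 → (u p ^ (1 / (p : ℝ)) < b ↔ v p / p < Real.log b.toReal) := by
      intro p hp
      rw [hroot p hp, ENNReal.ofReal_lt_iff_lt_toReal (Real.exp_pos _).le hbtop,
        Real.lt_log_iff_exp_lt hbpos]
    filter_upwards [hsub.eventually_div_lt_of_div_lt hn0 ((hiff n hn0).1 hnb),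
      eventually_ne_atTop 0] with p hp hp0
    exact (hiff p hp0).2 hp

/-- `sup_{x ∈ X_α} ∑_{y ∈ α^{-n}(x) ∩ X_α} ∏_{i < n} w(α^i(y))`. -/
noncomputable def weightedPreimageSum {X : Type*} [TopologicalSpace X] [MeasurableSpace X]
    (α : X → X) (w : X → ℝ≥0∞) (n : ℕ) : ℝ≥0∞ :=
  ⨆ x ∈ essentialSet α, ∑' y : essentialPreimage α n x, ∏ i ∈ Finset.range n, w (α^[i] (y : X))

lemma biSup_rpow {ι : Type*} (s : Set ι) (f : ι → ℝ≥0∞) {p : ℝ} (hp : 0 < p) :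
    ⨆ x ∈ s, f x ^ p = (⨆ x ∈ s, f x) ^ p := by
  have := (ENNReal.orderIsoRpow p hp).map_iSup₂ (fun x (_ : x ∈ s) => f x)
  simp only [ENNReal.orderIsoRpow_apply] at this
  exact this.symm

/-- A point `y` of the `(m + n)`-fold preimage is recorded with its intermediate point `α^m(y)`,
which lies in `X_α`; the product along the orbit splits there. -/
lemma weightedPreimageSum_add_le {X : Type*} [TopologicalSpace X] [MeasurableSpace X]
    [BorelSpace X] {α : X → X} (hα : Continuous α) (w : X → ℝ≥0∞) (m n : ℕ) :
    weightedPreimageSum α w (m + n) ≤ weightedPreimageSum α w m * weightedPreimageSum α w n := by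
  refine iSup₂_le fun x hx => ?_
  let e : essentialPreimage α (m + n) x →
      Σ z : essentialPreimage α n x, essentialPreimage α m (z : X) := fun y =>
    ⟨⟨α^[m] y, (mapsTo_essentialSet hα).iterate m y.2.1, by
      rw [← Function.iterate_add_apply, add_comm]; exact y.2.2⟩, ⟨y, y.2.1, rfl⟩⟩
  have he : Function.Injective e := fun y y' h => by
    have : ((e y).2 : X) = (e y').2 := by rw [h]
    exact Subtype.ext this
  let F : (Σ z : essentialPreimage α n x, essentialPreimage α m (z : X)) → ℝ≥0∞ := fun q =>
    (∏ i ∈ Finset.range m, w (α^[i] (q.2 : X))) * ∏ i ∈ Finset.range n, w (α^[i] (q.1 : X))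
  calc ∑' y : essentialPreimage α (m + n) x, ∏ i ∈ Finset.range (m + n), w (α^[i] (y : X))
      = ∑' y, F (e y) := by
        refine tsum_congr fun y => ?_
        simp only [F, e, Finset.prod_range_add, ← Function.iterate_add_apply, add_comm]
    _ ≤ ∑' q, F q := ENNReal.tsum_comp_le_tsum_of_injective he F
    _ = ∑' z : essentialPreimage α n x, (∑' y : essentialPreimage α m (z : X),
          ∏ i ∈ Finset.range m, w (α^[i] (y : X))) * ∏ i ∈ Finset.range n, w (α^[i] (z : X)) := by
        rw [ENNReal.tsum_sigma']
        exact tsum_congr fun z => by simp only [F, ENNReal.tsum_mul_right]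
    _ ≤ ∑' z : essentialPreimage α n x, weightedPreimageSum α w m *
          ∏ i ∈ Finset.range n, w (α^[i] (z : X)) := by
        refine ENNReal.tsum_le_tsum fun z => mul_le_mul_left ?_ _
        exact le_iSup₂_of_le (z : X) z.2.1 le_rfl
    _ ≤ weightedPreimageSum α w m * weightedPreimageSum α w n := by
        rw [ENNReal.tsum_mul_left]
        gcongr
        exact le_iSup₂_of_le x hx le_rfl

lemma weightedPreimageSum_one_ne_top {X : Type*} [TopologicalSpace X] [MeasurableSpace X]
    {α : X → X} (hfin : IsFiniteSheetedOnEssentialSet α) {w : X → ℝ≥0∞} {C : ℝ≥0∞} (hC : C ≠ ⊤)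
    (hw : ∀ x, w x ≤ C) : weightedPreimageSum α w 1 ≠ ⊤ := by
  set N := ⨆ x ∈ essentialSet α, (essentialPreimage α 1 x).encard with hN
  have hNtop : (N : ℝ≥0∞) ≠ ⊤ := by
    rw [Ne, ENat.toENNReal_eq_top]; exact hfin.ne
  refine ne_top_of_le_ne_top (ENNReal.mul_ne_top hNtop hC) (iSup₂_le fun x hx => ?_)
  calc ∑' y : essentialPreimage α 1 x, ∏ i ∈ Finset.range 1, w (α^[i] (y : X))
      ≤ ∑' _ : essentialPreimage α 1 x, C := ENNReal.tsum_le_tsum fun y => by simpa using hw y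
    _ = (essentialPreimage α 1 x).encard * C := ENNReal.tsum_set_const _ _
    _ ≤ N * C := by
        refine mul_le_mul_left (ENat.toENNReal_le.2 ?_) _
        exact le_iSup₂_of_le x hx le_rfl

lemma essentialGrowth_eq {X : Type*} [TopologicalSpace X] [MeasurableSpace X] (α : X → X)
    (a : X → ℝ) {n : ℕ} (hn : n ≠ 0) :
    essentialGrowth α a n
      = weightedPreimageSum α (fun x => ENNReal.ofReal (a x)) n ^ (1 / (n : ℝ)) :=
  biSup_rpow _ _ (by positivity)

lemma exists_tendsto_essentialGrowth {X : Type*} [TopologicalSpace X] [CompactSpace X]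
    [MeasurableSpace X] [BorelSpace X] {α : X → X} (hα : Continuous α)
    (hfin : IsFiniteSheetedOnEssentialSet α) {a : X → ℝ} (ha : Continuous a) :
    ∃ L : ℝ≥0∞, Tendsto (essentialGrowth α a) atTop (𝓝 L) := by
  have hw : ∀ x, ENNReal.ofReal (a x) ≤ ENNReal.ofReal ‖(⟨a, ha⟩ : C(X, ℝ))‖ := fun x =>
    ENNReal.ofReal_le_ofReal ((le_abs_self _).trans
      ((⟨a, ha⟩ : C(X, ℝ)).norm_coe_le_norm x))
  obtain ⟨L, hL⟩ := exists_tendsto_rpow_of_submultiplicative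
    (weightedPreimageSum_add_le hα fun x => ENNReal.ofReal (a x))
    (weightedPreimageSum_one_ne_top hfin ENNReal.ofReal_ne_top hw)
  refine ⟨L, hL.congr' ?_⟩
  filter_upwards [eventually_ne_atTop 0] with n hn
  exact (essentialGrowth_eq α a hn).symm

/-- The inverse rami-rate of a map that is finite-sheeted on its essential set is not `+∞`. -/
lemma inverseRamiRate_ne_top {X : Type*} [TopologicalSpace X] [MeasurableSpace X]
    [BorelSpace X] {α : X → X} (hα : Continuous α) (hfin : IsFiniteSheetedOnEssentialSet α) :
    inverseRamiRate α ≠ ⊤ := by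
  set B := weightedPreimageSum α 1 1 with hB
  have hBtop : B ≠ ⊤ :=
    weightedPreimageSum_one_ne_top hfin ENNReal.one_ne_top fun _ => le_rfl
  have hpow : ∀ n, n ≠ 0 → weightedPreimageSum α 1 n ≤ B ^ n := by
    intro n hn
    induction n, Nat.one_le_iff_ne_zero.2 hn using Nat.le_induction with
    | base => simp [hB]
    | succ n hn' ih =>
      refine (weightedPreimageSum_add_le hα 1 n 1).trans ?_
      rw [pow_succ]
      exact mul_le_mul_left (ih (by lia)) _
  rw [inverseRamiRate, Ne, ENNReal.log_eq_top_iff]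
  refine ne_top_of_le_ne_top hBtop (limsup_le_of_le (by isBoundedDefault) ?_)
  filter_upwards [eventually_ne_atTop 0] with n hn
  rw [biSup_rpow _ _ (by positivity)]
  have h1 : ⨆ x ∈ essentialSet α, ((essentialPreimage α n x).encard : ℝ≥0∞)
      = weightedPreimageSum α 1 n := by
    simp [weightedPreimageSum]
  rw [h1, one_div, ENNReal.rpow_inv_le_iff (by positivity), ENNReal.rpow_natCast]
  exact hpow n hn

/-! ### Bounds on the growth from orbit products -/

lemma ofReal_exp_mul_rpow (c : ℝ) {n : ℕ} (hn : n ≠ 0) :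
    ENNReal.ofReal (Real.exp (n * c)) ^ (1 / (n : ℝ)) = ENNReal.ofReal (Real.exp c) := by
  have : (n : ℝ) ≠ 0 := Nat.cast_ne_zero.2 hn
  rw [ENNReal.ofReal_rpow_of_pos (Real.exp_pos _), ← Real.exp_mul]
  congr 2
  field_simp

/-- All terms are nonnegative, so the sum over the preimages of `α^n(y)` dominates its term at `y`.
-/
lemma ofReal_exp_le_essentialGrowth {X : Type*} [TopologicalSpace X] [MeasurableSpace X]
    [BorelSpace X] {α : X → X} (hα : Continuous α) {a : X → ℝ} (ha0 : ∀ x, 0 ≤ a x) {c : ℝ}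
    {n : ℕ} (hn : n ≠ 0) {y : X} (hy : y ∈ essentialSet α)
    (h : Real.exp (n * c) ≤ ∏ i ∈ Finset.range n, a (α^[i] y)) :
    ENNReal.ofReal (Real.exp c) ≤ essentialGrowth α a n := by
  rw [← ofReal_exp_mul_rpow c hn]
  refine le_iSup₂_of_le (α^[n] y) ((mapsTo_essentialSet hα).iterate n hy) ?_
  refine ENNReal.rpow_le_rpow ?_ (by positivity)
  refine le_trans ?_ (ENNReal.le_tsum (⟨y, hy, rfl⟩ : essentialPreimage α n (α^[n] y)))
  rw [← ENNReal.ofReal_prod_of_nonneg fun i _ => ha0 _]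
  exact ENNReal.ofReal_le_ofReal h

lemma essentialGrowth_le {X : Type*} [TopologicalSpace X] [MeasurableSpace X]
    {α : X → X} {a : X → ℝ} (ha0 : ∀ x, 0 ≤ a x) {c : ℝ} {n : ℕ} (hn : n ≠ 0)
    (h : ∀ x, ∏ i ∈ Finset.range n, a (α^[i] x) ≤ Real.exp (n * c)) :
    essentialGrowth α a n ≤ ENNReal.ofReal (Real.exp c) *
      ⨆ x ∈ essentialSet α, ((essentialPreimage α n x).encard : ℝ≥0∞) ^ (1 / (n : ℝ)) := by
  refine iSup₂_le fun x hx => ?_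
  have hp : (0 : ℝ) ≤ 1 / n := by positivity
  calc (∑' y : essentialPreimage α n x,
        ∏ i ∈ Finset.range n, ENNReal.ofReal (a (α^[i] (y : X)))) ^ (1 / (n : ℝ))
      ≤ (∑' _ : essentialPreimage α n x, ENNReal.ofReal (Real.exp (n * c))) ^ (1 / (n : ℝ)) := by
        refine ENNReal.rpow_le_rpow (ENNReal.tsum_le_tsum fun y => ?_) hp
        rw [← ENNReal.ofReal_prod_of_nonneg fun i _ => ha0 _]
        exact ENNReal.ofReal_le_ofReal (h y)
    _ = ENNReal.ofReal (Real.exp c) * ((essentialPreimage α n x).encard : ℝ≥0∞) ^ (1 / (n : ℝ)) := by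
        rw [ENNReal.tsum_set_const, ENNReal.mul_rpow_of_nonneg _ _ hp, ofReal_exp_mul_rpow c hn,
          mul_comm]
    _ ≤ _ := by
        gcongr
        exact le_iSup₂_of_le (f := fun x (_ : x ∈ essentialSet α) =>
          ((essentialPreimage α n x).encard : ℝ≥0∞) ^ (1 / (n : ℝ))) x hx le_rfl

lemma log_ofReal_exp (c : ℝ) : ENNReal.log (ENNReal.ofReal (Real.exp c)) = c := by
  rw [ENNReal.log_ofReal_of_pos (Real.exp_pos c), Real.log_exp]

/-! ### The variational estimate -/

theorem theoremt {X : Type*} [TopologicalSpace X] [CompactSpace X] [T2Space X] [Nonempty X]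
    [MeasurableSpace X] [BorelSpace X]
    (α : X → X) (hα : Continuous α) (hfin : IsFiniteSheetedOnEssentialSet α)
    (a : X → ℝ) (ha : Continuous a) (ha0 : ∀ x, 0 ≤ a x) :
    (∃ L : ℝ≥0∞, Tendsto (essentialGrowth α a) atTop (𝓝 L)) ∧
    ∃ M : EReal,
      IsGreatest ((fun μ : Measure X => extIntegral μ (lnFun a)) '' invariantMeasures α) M ∧
      IsGreatest ((fun μ : Measure X => extIntegral μ (lnFun a)) '' ergodicMeasures α) M ∧
      M ≤ essentialSpectralPotential α a ∧
      essentialSpectralPotential α a ≤ M + inverseRamiRate α := by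
  obtain ⟨L, hL⟩ := exists_tendsto_essentialGrowth hα hfin ha
  refine ⟨⟨L, hL⟩, ?_⟩
  -- Krylov–Bogolyubov argument along the orbit of an arbitrary point.
  have hne : (invariantStates α).Nonempty := by
    obtain ⟨U, hU⟩ := Ultrafilter.exists_le (atTop : Filter ℕ)
    obtain ⟨Λ, hΛ, -⟩ := empirical_limit_mem_invariantStates (α := α) U hU
      fun _ => Classical.arbitrary X
    exact ⟨Λ, hΛ⟩
  -- Evaluation at each truncation is a coordinate projection, hence continuous and linear for the
  -- product topology.
  obtain ⟨Λ, hΛ, hmax⟩ := exists_extremePoint_isMaxOn_iInf (isCompact_invariantStates α) hne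
    (fun k => ContinuousLinearMap.proj (R := ℝ) (truncLog a ha k))
    fun Λ hΛ j k hjk => invariantStates_mono hΛ fun x => truncLog_antitone a ha x hjk
  obtain ⟨μ, hμ, rfl⟩ := exists_invariantMeasure_of_mem_invariantStates hα hΛ.1
  have hμprob := hμ.1
  have hle : ∀ ν ∈ invariantMeasures α, extIntegral ν (lnFun a) ≤ extIntegral μ (lnFun a) := by
    intro ν hν
    have := hν.1
    rw [extIntegral_lnFun ν a ha, extIntegral_lnFun μ a ha]
    exact hmax (integralFunctional_mem_invariantStates hν.2.2)
  have hpot : essentialSpectralPotential α a = ENNReal.log L := by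
    rw [essentialSpectralPotential, hL.limUnder_eq]
  refine ⟨extIntegral μ (lnFun a), ⟨⟨μ, hμ, rfl⟩, ?_⟩,
    ⟨⟨μ, ⟨hμ, ergodic_of_mem_extremePoints hμ hΛ⟩, rfl⟩, ?_⟩, ?_, ?_⟩
  · rintro _ ⟨ν, hν, rfl⟩
    exact hle ν hν
  · rintro _ ⟨ν, hν, rfl⟩
    exact hle ν hν.1
  · rw [hpot]
    refine EReal.ge_of_forall_gt_iff_ge.1 fun c hc => ?_
    rw [extIntegral_lnFun μ a ha] at hc
    have hck : ∀ k, c ≤ integralFunctional μ (truncLog a ha k) := fun k =>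
      EReal.coe_le_coe_iff.1 (hc.le.trans (iInf_le _ k))
    rw [← log_ofReal_exp c]
    refine ENNReal.log_le_log (ge_of_tendsto hL ?_)
    filter_upwards [eventually_ne_atTop 0] with n hn
    obtain ⟨y, hy, hprod⟩ := exists_essential_exp_le_prod hα hμ ha ha0 hck n
    exact ofReal_exp_le_essentialGrowth hα ha0 hn hy hprod
  · rw [hpot]
    have hMtop : extIntegral μ (lnFun a) ≠ ⊤ := by
      rw [extIntegral_lnFun μ a ha]
      exact ((iInf_le (fun k => (integralFunctional μ (truncLog a ha k) : EReal)) 0).trans_lt (EReal.coe_lt_top _)).ne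
    -- The two side conditions exclude sums of the form `⊥ + ⊤` and `⊤ + ⊥`; the maximum itself may
    -- be `⊥`.
    refine EReal.le_add_of_forall_gt (Or.inr (inverseRamiRate_ne_top hα hfin)) (Or.inl hMtop)
      fun c hc b hb => ?_
    obtain ⟨c', hc', hcc'⟩ := EReal.lt_iff_exists_real_btwn.1 hc
    refine le_trans ?_ (add_le_add hcc'.le hb.le)
    have hev := eventually_prod_le_exp α ha ha0 (c := c') fun Λ hΛ => by
      refine (hmax hΛ).trans_lt ?_
      rw [extIntegral_lnFun μ a ha] at hc'
      exact hc'
    rw [← log_ofReal_exp c', inverseRamiRate, ← ENNReal.log_mul_add]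
    refine ENNReal.log_le_log ?_
    -- As the limit `L` exists, it can be compared as a limsup with the limsup defining `ω(α)`.
    rw [← ENNReal.limsup_const_mul_of_ne_top ENNReal.ofReal_ne_top, ← hL.limsup_eq]
    refine limsup_le_limsup ?_
    filter_upwards [hev, eventually_ne_atTop 0] with n hn hn0
    exact essentialGrowth_le ha0 hn0 hn
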